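/- Theorem 4.1. For a complex $n\times n$ matrix $X$ with no eigenvalue in $(-\infty,0]$ and a real number $s$, let $X^s$ be defined by the Dunford integral $$X^{s}=\frac{1}{2\pi i}\int_\Gamma z^{s}(zI-X)^{-1}\,dz,$$ where $z^s$ is the principal branch on $\mathbb{C}\setminus(-\infty,0]$ and $\Gamma$ is a closed piecewise $C^1$ curve in the resolvent set of $X$ that avoids $(-\infty,0]$ and winds once around each eigenvalue of $X$. A complex $n\times n$ matrix is called accretive if its real part $\frac12(X+X^*)$ is positive definite. Let $A,B$ be accretive $n\times n$ matrices and $0<\lambda<1$. Then $A^{1/2}$ and $A^{-1/2}$ are well defined (an admissible curve $\Gamma$ exists and the integral does not depend on its choice); the matrix $A^{-1/2}BA^{-1/2}$ has no eigenvalue in $(-\infty,0]$, and its power $(A^{-1/2}BA^{-1/2})^\lambda$ is well defined in the same sense; the integral defining the Raïssouli–Drury weighted geometric mean $$A\sharp_\lambda B=\frac{\sin(\lambda\pi)}{\pi}\int_0^\infty t^{\lambda-1}(A^{-1}+tB^{-1})^{-1}\,dt$$ converges absolutely; and $$A\sharp_\lambda B=A^{1/2}\left(A^{-1/2}BA^{-1/2}\right)^{\lambda}A^{1/2}.$$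 -/

import Mathlib

open MeasureTheory Set
open scoped Matrix ComplexOrder

noncomputable section

namespace AccretiveMean

/-- A complex square matrix is accretive if its real part `(A + A*) / 2` is positive definite. -/
def IsAccretive {n : ℕ} (A : Matrix (Fin n) (Fin n) ℂ) : Prop :=
  ((1 / 2 : ℂ) • (A + Aᴴ)).PosDef

/-- The parametrized curve `γ : [0, 1] → ℂ` is closed and piecewise continuously differentiable:
there is a partition `0 = τ 0 ≤ τ 1 ≤ ⋯ ≤ τ N = 1` such that `γ` is `C¹` on each closed
subinterval (with one-sided derivatives at its end points). Values outside `[0, 1]` play no role. -/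
def IsClosedContour (γ : ℝ → ℂ) : Prop :=
  γ 0 = γ 1 ∧
    ∃ (N : ℕ) (τ : ℕ → ℝ), Monotone τ ∧ τ 0 = 0 ∧ τ N = 1 ∧
      ∀ i < N, ContDiffOn ℝ 1 γ (Icc (τ i) (τ (i + 1)))

/-- The contour integral `∫_γ g(z) dz` over a curve parametrized by `[0, 1]`. -/
def contourIntegral (γ : ℝ → ℂ) (g : ℂ → ℂ) : ℂ :=
  ∫ t in (0 : ℝ)..1, g (γ t) * deriv γ t

/-- The winding number of the closed curve `γ` around the point `μ`. -/
def windingNumber (γ : ℝ → ℂ) (μ : ℂ) : ℂ :=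
  (2 * Real.pi * Complex.I)⁻¹ * contourIntegral γ (fun z => (z - μ)⁻¹)

/-- `γ` may be used in the Dunford integral of a function that is analytic on `ℂ ∖ (-∞, 0]`,
at the matrix `X`: it is a closed curve that avoids `(-∞, 0]`, lies in the resolvent set of `X`,
and winds once around each eigenvalue of `X`. -/
structure IsDunfordContour {n : ℕ} (X : Matrix (Fin n) (Fin n) ℂ) (γ : ℝ → ℂ) : Prop where
  isClosedContour : IsClosedContour γ
  mem_slitPlane : ∀ t ∈ Icc (0 : ℝ) 1, γ t ∈ Complex.slitPlane
  mem_resolventSet : ∀ t ∈ Icc (0 : ℝ) 1, γ t ∈ resolventSet ℂ X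
  winding_eq_one : ∀ μ ∈ spectrum ℂ X, windingNumber γ μ = 1

/-- The matrix `(1 / 2πi) ∫_γ f(z) (z I - X)⁻¹ dz`, the integral being taken entrywise. -/
def dunfordIntegral {n : ℕ} (f : ℂ → ℂ) (X : Matrix (Fin n) (Fin n) ℂ) (γ : ℝ → ℂ) :
    Matrix (Fin n) (Fin n) ℂ :=
  Matrix.of fun i j =>
    (2 * Real.pi * Complex.I)⁻¹ *
      contourIntegral γ (fun z => f z * (z • (1 : Matrix (Fin n) (Fin n) ℂ) - X)⁻¹ i j)

open Classical in
/-- The power `X ^ s` given by the Dunford integral of the principal branch of `z ^ s` on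
`ℂ ∖ (-∞, 0]` (and `0` if `X` has no admissible contour). -/
def dunfordPow {n : ℕ} (X : Matrix (Fin n) (Fin n) ℂ) (s : ℝ) : Matrix (Fin n) (Fin n) ℂ :=
  if h : ∃ γ, IsDunfordContour X γ then
    dunfordIntegral (fun z => z ^ (s : ℂ)) X h.choose
  else 0

/-- The Dunford integral that defines `X ^ s` is legitimate: there is an admissible contour, and
every admissible contour gives the same matrix. -/
def DunfordPowWellDefined {n : ℕ} (X : Matrix (Fin n) (Fin n) ℂ) (s : ℝ) : Prop :=
  (∃ γ, IsDunfordContour X γ) ∧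
    ∀ γ, IsDunfordContour X γ →
      dunfordIntegral (fun z => z ^ (s : ℂ)) X γ = dunfordPow X s

/-- The integrand `t ^ (l - 1) (A⁻¹ + t B⁻¹)⁻¹` of the weighted geometric mean. -/
def meanIntegrand {n : ℕ} (A B : Matrix (Fin n) (Fin n) ℂ) (l t : ℝ) :
    Matrix (Fin n) (Fin n) ℂ :=
  ((t ^ (l - 1) : ℝ) : ℂ) • (A⁻¹ + (t : ℂ) • B⁻¹)⁻¹

/-- The Raïssouli–Drury weighted geometric mean
`(sin (lπ) / π) ∫_0^∞ t ^ (l - 1) (A⁻¹ + t B⁻¹)⁻¹ dt`, the integral being taken entrywise. -/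
def weightedGeometricMean {n : ℕ} (A B : Matrix (Fin n) (Fin n) ℂ) (l : ℝ) :
    Matrix (Fin n) (Fin n) ℂ :=
  ((Real.sin (l * Real.pi) / Real.pi : ℝ) : ℂ) •
    Matrix.of fun i j => ∫ t in Ioi (0 : ℝ), meanIntegrand A B l t i j

end AccretiveMean

end

/-! Dunford integrals are identified with polynomials in the matrix. Dividing a function `f`,
holomorphic on the slit plane, by the characteristic polynomial χ of `X` gives `f = P + χ g`;
`HasHolCalc` records `P(X)` as the value of `f` at `X`. Multiplied by the resolvent, `χ g` becomes
`g` times an adjugate, which has a primitive and integrates to zero; `P(z)` can be replaced by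
`P(X)` up to an entire term; and the resolvent integrates to `2πi` times the identity, by
Cayley–Hamilton and the winding condition. So every admissible contour yields `P(X)`
(`HasHolCalc.dunfordIntegral_eq`), and the laws of exponents follow from multiplicativity
(`HasHolCalc.mul`).

For `0 < l < 1` the scalar formula `z^l = (sin lπ / π) ∫ t^(l-1) z (z + t)⁻¹ dt`
(`cpow_eq_integral`) passes to matrices by Fubini (`HasHolCalc.apply_eq_integral`).

Put `D = A^(1/2)`, `E = A^(-1/2)`, `C = E B E`. An eigenvalue `r ≤ 0` of `C` would give `B x = r A
x` with `x ≠ 0`, against the positivity of both real parts. Finally `(A⁻¹ + t B⁻¹)⁻¹ = D C (C + t)⁻¹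
D`, so the mean is `D C^l D`. -/

namespace AccretiveMean

/-! ### Integration along closed piecewise C¹ curves -/

theorem intervalIntegrable_comp_mul_deriv_of_contDiffOn {γ : ℝ → ℂ} {a b : ℝ} (hab : a ≤ b)
    (hγ : ContDiffOn ℝ 1 γ (Icc a b)) {U : Set ℂ} {f : ℂ → ℂ} (hf : ContinuousOn f U)
    (hU : ∀ t ∈ Icc a b, γ t ∈ U) :
    IntervalIntegrable (fun t => f (γ t) * deriv γ t) volume a b := by
  rcases hab.eq_or_lt with rfl | hlt
  · simp
  have hc : ContinuousOn (fun t => f (γ t) * derivWithin γ (Icc a b) t) (Icc a b) :=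
    (hf.comp hγ.continuousOn hU).mul
      (hγ.continuousOn_derivWithin (uniqueDiffOn_Icc hlt) le_rfl)
  rw [← uIcc_of_le hab] at hc
  -- At a break point `deriv γ` need not be the one-sided derivative, so agreement is claimed on the
  -- open interval only.
  refine (hc.intervalIntegrable (μ := volume)).congr_uIoo ?_
  intro t ht
  rw [uIoo_of_le hab] at ht
  simp only [derivWithin_of_mem_nhds (Icc_mem_nhds ht.1 ht.2), uIcc_of_le hab]

theorem integral_comp_mul_deriv_of_contDiffOn {γ : ℝ → ℂ} {a b : ℝ} (hab : a ≤ b)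
    (hγ : ContDiffOn ℝ 1 γ (Icc a b)) {U : Set ℂ} {f F : ℂ → ℂ} (hf : ContinuousOn f U)
    (hF : ∀ z ∈ U, HasDerivAt F (f z) z) (hU : ∀ t ∈ Icc a b, γ t ∈ U) :
    ∫ t in a..b, f (γ t) * deriv γ t = F (γ b) - F (γ a) := by
  refine intervalIntegral.integral_eq_sub_of_hasDerivAt_of_le (f := fun t => F (γ t)) hab ?_ ?_
    (intervalIntegrable_comp_mul_deriv_of_contDiffOn hab hγ hf hU)
  · intro t ht
    exact (hF _ (hU t ht)).continuousAt.comp_continuousWithinAt (hγ.continuousOn t ht)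
  · intro t ht
    have hd : HasDerivAt γ (deriv γ t) t :=
      ((hγ.differentiableOn one_ne_zero).differentiableAt (Icc_mem_nhds ht.1 ht.2)).hasDerivAt
    exact (hF _ (hU t (Ioo_subset_Icc_self ht))).comp t hd

theorem IsClosedContour.intervalIntegrable {γ : ℝ → ℂ} (hγ : IsClosedContour γ) {U : Set ℂ}
    {f : ℂ → ℂ} (hf : ContinuousOn f U) (hU : ∀ t ∈ Icc (0 : ℝ) 1, γ t ∈ U) :
    IntervalIntegrable (fun t => f (γ t) * deriv γ t) volume 0 1 := by
  obtain ⟨-, N, τ, hτ, h0, h1, hC⟩ := hγ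
  rw [← h0, ← h1]
  refine IntervalIntegrable.trans_iterate fun k hk => ?_
  refine intervalIntegrable_comp_mul_deriv_of_contDiffOn (hτ k.le_succ) (hC k hk) hf ?_
  intro t ht
  exact hU t ⟨h0 ▸ (hτ k.zero_le).trans ht.1, h1 ▸ ht.2.trans (hτ hk)⟩

/-- The integral over a closed contour of a function with a primitive is zero. -/
theorem IsClosedContour.contourIntegral_eq_zero {γ : ℝ → ℂ} (hγ : IsClosedContour γ) {U : Set ℂ}
    {f F : ℂ → ℂ} (hf : ContinuousOn f U) (hF : ∀ z ∈ U, HasDerivAt F (f z) z)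
    (hU : ∀ t ∈ Icc (0 : ℝ) 1, γ t ∈ U) : contourIntegral γ f = 0 := by
  obtain ⟨hcl, N, τ, hτ, h0, h1, hC⟩ := hγ
  have hU' : ∀ k < N, ∀ t ∈ Icc (τ k) (τ (k + 1)), γ t ∈ U := fun k hk t ht =>
    hU t ⟨h0 ▸ (hτ k.zero_le).trans ht.1, h1 ▸ ht.2.trans (hτ hk)⟩
  have hsum := intervalIntegral.sum_integral_adjacent_intervals (μ := volume) (n := N)
    (a := τ) (f := fun t => f (γ t) * deriv γ t) fun k hk =>
      intervalIntegrable_comp_mul_deriv_of_contDiffOn (hτ k.le_succ) (hC k hk) hf (hU' k hk)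
  rw [h0, h1] at hsum
  rw [contourIntegral, ← hsum, Finset.sum_congr rfl fun k hk =>
    integral_comp_mul_deriv_of_contDiffOn (hτ k.le_succ) (hC k (Finset.mem_range.1 hk)) hf hF
      (hU' k (Finset.mem_range.1 hk)), Finset.sum_range_sub (fun k => F (γ (τ k))), h0, h1, hcl,
    sub_self]

theorem IsClosedContour.contourIntegral_add {γ : ℝ → ℂ} (hγ : IsClosedContour γ) {U : Set ℂ}
    {f g : ℂ → ℂ} (hf : ContinuousOn f U) (hg : ContinuousOn g U)
    (hU : ∀ t ∈ Icc (0 : ℝ) 1, γ t ∈ U) :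
    contourIntegral γ (fun z => f z + g z) = contourIntegral γ f + contourIntegral γ g := by
  simp only [contourIntegral, add_mul]
  exact intervalIntegral.integral_add (hγ.intervalIntegrable hf hU) (hγ.intervalIntegrable hg hU)

theorem contourIntegral_const_mul (γ : ℝ → ℂ) (c : ℂ) (f : ℂ → ℂ) :
    contourIntegral γ (fun z => c * f z) = c * contourIntegral γ f := by
  simp only [contourIntegral, mul_assoc, intervalIntegral.integral_const_mul]

theorem contourIntegral_congr {γ : ℝ → ℂ} {f g : ℂ → ℂ}
    (h : ∀ t ∈ Icc (0 : ℝ) 1, f (γ t) = g (γ t)) :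
    contourIntegral γ f = contourIntegral γ g := by
  refine intervalIntegral.integral_congr fun t ht => ?_
  rw [uIcc_of_le zero_le_one] at ht
  simp only [h t ht]

/-! ### Primitives on the slit plane -/

/-- The principal square root of a point of the slit plane lies in the right half-plane. -/
theorem re_exp_log_div_two_pos {z : ℂ} (hz : z ∈ Complex.slitPlane) :
    0 < (Complex.exp (Complex.log z / 2)).re := by
  rw [Complex.exp_re]
  have him : (Complex.log z / 2).im = Complex.arg z / 2 := by
    rw [show (2 : ℂ) = ((2 : ℝ) : ℂ) by norm_num, Complex.div_ofReal_im, Complex.log_im]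
  have h1 := Complex.neg_pi_lt_arg z
  have h2 := (Complex.arg_le_pi z).lt_of_ne (Complex.mem_slitPlane_iff_arg.1 hz).1
  refine mul_pos (Real.exp_pos _) (Real.cos_pos_of_mem_Ioo ?_)
  rw [him]
  constructor <;> linarith

theorem exp_log_div_two_sq {z : ℂ} (hz : z ≠ 0) : Complex.exp (Complex.log z / 2) ^ 2 = z := by
  rw [← Complex.exp_nat_mul]
  convert Complex.exp_log hz using 2
  push_cast
  ring

theorem sq_mem_slitPlane {w : ℂ} (hw : 0 < w.re) : w ^ 2 ∈ Complex.slitPlane := by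
  rw [Complex.mem_slitPlane_iff]
  by_cases h : w.im = 0
  · left
    simp [sq, h, hw]
  · right
    simp [sq, h, hw.ne', mul_comm w.im]

/-- A holomorphic function on the slit plane has a primitive. -/
theorem exists_primitive_slitPlane {f : ℂ → ℂ} (hf : DifferentiableOn ℂ f Complex.slitPlane) :
    ∃ F : ℂ → ℂ, ∀ z ∈ Complex.slitPlane, HasDerivAt F (f z) z := by
  have ho : IsOpen {w : ℂ | 0 < w.re} := isOpen_lt continuous_const Complex.continuous_re
  -- The substitution `z = w²` moves `f(z) dz` to the right half-plane, which is convex; the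
  -- primitive found there is pulled back by the principal root.
  have hd : DifferentiableOn ℂ (fun w => f (w ^ 2) * (2 * w)) {w : ℂ | 0 < w.re} :=
    (hf.comp (by fun_prop) fun w hw => sq_mem_slitPlane hw).mul (by fun_prop)
  obtain ⟨G, hG⟩ := (convex_halfSpace_re_gt 0).exists_forall_hasDerivWithinAt hd
  refine ⟨fun z => G (Complex.exp (Complex.log z / 2)), fun z hz => ?_⟩
  have hz0 := Complex.slitPlane_ne_zero hz
  have hw := re_exp_log_div_two_pos hz
  have h1 := (hG _ hw).hasDerivAt (ho.mem_nhds hw)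
  have h2 := h1.comp z ((Complex.hasDerivAt_log hz).div_const 2).cexp
  convert! h2 using 1
  have hsq := exp_log_div_two_sq hz0
  rw [hsq]
  field_simp
  rw [hsq]

theorem IsClosedContour.contourIntegral_eq_zero_of_differentiableOn {γ : ℝ → ℂ}
    (hγ : IsClosedContour γ) (hU : ∀ t ∈ Icc (0 : ℝ) 1, γ t ∈ Complex.slitPlane) {f : ℂ → ℂ}
    (hf : DifferentiableOn ℂ f Complex.slitPlane) : contourIntegral γ f = 0 := by
  obtain ⟨F, hF⟩ := exists_primitive_slitPlane hf
  exact hγ.contourIntegral_eq_zero hf.continuousOn hF hU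

/-! ### Holomorphic functional calculus by polynomial division -/

variable {n : ℕ} {X : Matrix (Fin n) (Fin n) ℂ} {γ : ℝ → ℂ}

open Polynomial in
/-- Division of a holomorphic function by a product of linear factors. -/
theorem exists_eq_eval_add_prod_mul (s : Multiset ℂ) (hs : ∀ μ ∈ s, μ ∈ Complex.slitPlane)
    {f : ℂ → ℂ} (hf : DifferentiableOn ℂ f Complex.slitPlane) :
    ∃ (P : ℂ[X]) (g : ℂ → ℂ), DifferentiableOn ℂ g Complex.slitPlane ∧
      ∀ z, f z = P.eval z + (s.map fun μ => z - μ).prod * g z := by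
  induction s using Multiset.induction_on generalizing f with
  | empty => exact ⟨0, f, hf, by simp⟩
  | cons μ s ih =>
    have hμ : Complex.slitPlane ∈ nhds μ :=
      Complex.isOpen_slitPlane.mem_nhds (hs μ (Multiset.mem_cons_self _ _))
    -- Since `f(z) = f(μ) + (z - μ) dslope f μ z` and the slope is again holomorphic, the induction
    -- hypothesis is applied to the slope.
    obtain ⟨P, g, hg, h⟩ := ih (fun ν hν => hs ν (Multiset.mem_cons_of_mem hν))
      ((Complex.differentiableOn_dslope hμ).2 hf)
    refine ⟨C (f μ) + (X - C μ) * P, g, hg, fun z => ?_⟩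
    have h1 := sub_smul_dslope f μ z
    rw [smul_eq_mul, h z] at h1
    simp only [eval_add, eval_C, eval_mul, eval_sub, eval_X, Multiset.map_cons, Multiset.prod_cons]
    linear_combination -h1

open Polynomial in
/-- `M = P(X)` for some polynomial `P` that agrees with `f` up to a holomorphic multiple of the
characteristic polynomial of `X`; so `M` is the value at `X` of the holomorphic functional
calculus. -/
def HasHolCalc (f : ℂ → ℂ) (X M : Matrix (Fin n) (Fin n) ℂ) : Prop :=
  ∃ (P : ℂ[X]) (g : ℂ → ℂ), DifferentiableOn ℂ g Complex.slitPlane ∧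
    (∀ z ∈ Complex.slitPlane, f z = P.eval z + X.charpoly.eval z * g z) ∧ aeval X P = M

theorem charpoly_eval_eq_prod (X : Matrix (Fin n) (Fin n) ℂ) (z : ℂ) :
    X.charpoly.eval z = (X.charpoly.roots.map fun μ => z - μ).prod := by
  conv_lhs => rw [(IsAlgClosed.splits X.charpoly).eq_prod_roots_of_monic X.charpoly_monic]
  simp [Polynomial.eval_multiset_prod, Multiset.map_map]

theorem mem_spectrum_of_mem_roots {μ : ℂ} (h : μ ∈ X.charpoly.roots) : μ ∈ spectrum ℂ X :=
  Matrix.mem_spectrum_iff_isRoot_charpoly.2 (Polynomial.isRoot_of_mem_roots h)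

theorem exists_hasHolCalc (hX : spectrum ℂ X ⊆ Complex.slitPlane) {f : ℂ → ℂ}
    (hf : DifferentiableOn ℂ f Complex.slitPlane) : ∃ M, HasHolCalc f X M := by
  obtain ⟨P, g, hg, h⟩ := exists_eq_eval_add_prod_mul X.charpoly.roots
    (fun μ hμ => hX (mem_spectrum_of_mem_roots hμ)) hf
  exact ⟨_, P, g, hg, fun z _ => by rw [h, charpoly_eval_eq_prod], rfl⟩

/-- In the product of two decompositions every term except `P Q` keeps a factor χ. This turns scalar
laws of exponents into matrix identities. -/
theorem HasHolCalc.mul {f g : ℂ → ℂ} {M N : Matrix (Fin n) (Fin n) ℂ} (hf : HasHolCalc f X M)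
    (hg : HasHolCalc g X N) : HasHolCalc (fun z => f z * g z) X (M * N) := by
  obtain ⟨P, u, hu, hP, rfl⟩ := hf
  obtain ⟨Q, v, hv, hQ, rfl⟩ := hg
  refine ⟨P * Q, fun z => P.eval z * v z + u z * Q.eval z + u z * X.charpoly.eval z * v z, ?_,
    fun z hz => ?_, map_mul _ _ _⟩
  · have h1 := P.differentiable.differentiableOn (s := Complex.slitPlane)
    have h2 := Q.differentiable.differentiableOn (s := Complex.slitPlane)
    have h3 := X.charpoly.differentiable.differentiableOn (s := Complex.slitPlane)
    fun_prop
  · simp only [hP z hz, hQ z hz, Polynomial.eval_mul]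
    ring

theorem HasHolCalc.congr {f g : ℂ → ℂ} {M : Matrix (Fin n) (Fin n) ℂ} (hf : HasHolCalc f X M)
    (h : EqOn g f Complex.slitPlane) : HasHolCalc g X M := by
  obtain ⟨P, u, hu, hP, rfl⟩ := hf
  exact ⟨P, u, hu, fun z hz => by rw [h hz, hP z hz], rfl⟩

theorem hasHolCalc_polynomial (P : Polynomial ℂ) :
    HasHolCalc (fun z => P.eval z) X (Polynomial.aeval X P) :=
  ⟨P, 0, differentiableOn_const 0, fun z _ => by simp, rfl⟩

/-! ### Regularity of the resolvent and the adjugate -/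

theorem isUnit_smul_one_sub {z : ℂ} (hz : z ∈ resolventSet ℂ X) :
    IsUnit (z • (1 : Matrix (Fin n) (Fin n) ℂ) - X) := by
  simpa [resolventSet, Algebra.algebraMap_eq_smul_one] using hz

theorem det_smul_one_sub (z : ℂ) :
    (z • (1 : Matrix (Fin n) (Fin n) ℂ) - X).det = X.charpoly.eval z := by
  rw [Matrix.eval_charpoly, Matrix.scalar_apply, Matrix.smul_one_eq_diagonal]

theorem charpoly_eval_ne_zero {z : ℂ} (hz : z ∈ resolventSet ℂ X) : X.charpoly.eval z ≠ 0 := by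
  rw [← det_smul_one_sub]
  exact ((Matrix.isUnit_iff_isUnit_det _).1 (isUnit_smul_one_sub hz)).ne_zero

theorem continuous_adjugate_smul_one_sub : Continuous
    fun z : ℂ => (z • (1 : Matrix (Fin n) (Fin n) ℂ) - X).adjugate :=
  Continuous.matrix_adjugate (by fun_prop)

/-- By Cramer's rule the resolvent is the adjugate divided by χ, which has no zero on the resolvent
set. -/
theorem continuousOn_resolvent : ContinuousOn
    (fun z : ℂ => (z • (1 : Matrix (Fin n) (Fin n) ℂ) - X)⁻¹) (resolventSet ℂ X) := by
  simp only [Matrix.inv_def, Ring.inverse_eq_inv', det_smul_one_sub]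
  exact ContinuousOn.smul (X.charpoly.continuous.continuousOn.inv₀ fun z hz =>
    charpoly_eval_ne_zero hz) continuous_adjugate_smul_one_sub.continuousOn

theorem differentiable_det {m : ℕ} {f : ℂ → Matrix (Fin m) (Fin m) ℂ}
    (hf : ∀ i j, Differentiable ℂ fun z => f z i j) : Differentiable ℂ fun z => (f z).det := by
  simp only [Matrix.det_apply]
  fun_prop

theorem differentiable_adjugate_smul_one_sub (i j : Fin n) : Differentiable ℂ
    fun z : ℂ => (z • (1 : Matrix (Fin n) (Fin n) ℂ) - X).adjugate i j := by
  simp only [Matrix.adjugate_apply]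
  refine differentiable_det fun k l => ?_
  -- Row `j` is replaced by a constant unit vector; the other rows are affine in `z`.
  by_cases hk : k = j
  · subst hk; simp
  · simp only [Matrix.updateRow_ne hk, Matrix.sub_apply, Matrix.smul_apply]
    fun_prop

/-- `P(z) - P(X)` is divisible by `z - X`, with a quotient that is entire in `z`. -/
theorem exists_eval_smul_sub_aeval (P : Polynomial ℂ) :
    ∃ S : ℂ → Matrix (Fin n) (Fin n) ℂ, (∀ i j, Differentiable ℂ fun z => S z i j) ∧
      ∀ z, P.eval z • (1 : Matrix (Fin n) (Fin n) ℂ) - Polynomial.aeval X P = S z * (z • 1 - X) := by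
  induction P using Polynomial.induction_on with
  | C a => exact ⟨0, fun i j => differentiable_const 0, fun z => by
      simp [Algebra.algebraMap_eq_smul_one]⟩
  | add P Q hP hQ =>
    obtain ⟨S, hS, hS'⟩ := hP
    obtain ⟨T, hT, hT'⟩ := hQ
    refine ⟨S + T, fun i j => (hS i j).add (hT i j), fun z => ?_⟩
    rw [Pi.add_apply, add_mul, ← hS', ← hT', Polynomial.eval_add, map_add, add_smul]
    abel
  | monomial m a h =>
    obtain ⟨S, hS, hS'⟩ := h
    refine ⟨fun z => z • S z + a • X ^ m, fun i j => ?_, fun z => ?_⟩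
    · have := hS i j
      simp only [Matrix.add_apply, Matrix.smul_apply]
      fun_prop
    · rw [add_mul, smul_mul_assoc, ← hS' z]
      simp only [Polynomial.eval_mul, Polynomial.eval_C, Polynomial.eval_pow, Polynomial.eval_X,
        map_mul, map_pow, Polynomial.aeval_X, Polynomial.aeval_C, Algebra.algebraMap_eq_smul_one,
        smul_mul_assoc, one_mul, mul_sub, mul_smul_comm, mul_one, smul_sub, smul_smul, pow_succ]
      rw [show z * (a * z ^ m) = a * (z ^ m * z) by ring, mul_comm z a]
      abel

/-! ### The integral of the resolvent -/

theorem continuousOn_prod_inv {S : Set ℂ} (s : Multiset ℂ) (hs : ∀ μ ∈ s, μ ∈ S) :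
    ContinuousOn (fun z => (s.map fun μ => (z - μ)⁻¹).prod) Sᶜ := by
  refine continuousOn_multiset_prod _ fun μ hμ => ?_
  refine ContinuousOn.inv₀ (by fun_prop) fun z hz h0 => hz ?_
  rw [sub_eq_zero.1 h0]
  exact hs μ hμ

/-- If `γ` winds once around each point of `S`, then a product of at least two factors
`(z - μ)⁻¹` with `μ ∈ S` has integral zero over `γ`. -/
theorem contourIntegral_prod_inv_eq_zero (hγ : IsClosedContour γ) {S : Set ℂ}
    (hS : ∀ t ∈ Icc (0 : ℝ) 1, γ t ∉ S) (hw : ∀ μ ∈ S, windingNumber γ μ = 1) (s : Multiset ℂ)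
    (hs : ∀ μ ∈ s, μ ∈ S) (hcard : 2 ≤ s.card) :
    contourIntegral γ (fun z => (s.map fun μ => (z - μ)⁻¹).prod) = 0 := by
  have hU : ∀ t ∈ Icc (0 : ℝ) 1, γ t ∈ Sᶜ := hS
  induction s using Multiset.strongInductionOn with
  | ih s ih =>
  by_cases hall : ∃ a ∈ s, ∃ b ∈ s, a ≠ b
  · obtain ⟨a, ha, b, hb, hab⟩ := hall
    obtain ⟨u, rfl⟩ := Multiset.exists_cons_of_mem ha
    obtain ⟨v, rfl⟩ := Multiset.exists_cons_of_mem ((Multiset.mem_cons.1 hb).resolve_left hab.symm)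
    have ha' := hs a ha
    have hb' := hs b hb
    have hv : ∀ μ ∈ v, μ ∈ S := fun μ hμ => hs μ (by simp [hμ])
    have hav : ∀ μ ∈ a ::ₘ v, μ ∈ S := fun μ hμ => hs μ (by simp at hμ ⊢; tauto)
    have hbv : ∀ μ ∈ b ::ₘ v, μ ∈ S := fun μ hμ => hs μ (by simp at hμ ⊢; tauto)
    have hne : a - b ≠ 0 := sub_ne_zero.2 hab
    -- Partial fractions for two distinct poles `a` and `b` remove one factor.
    have key : contourIntegral γ (fun z => ((a ::ₘ b ::ₘ v).map fun μ => (z - μ)⁻¹).prod) =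
        (a - b)⁻¹ * (contourIntegral γ (fun z => ((a ::ₘ v).map fun μ => (z - μ)⁻¹).prod) +
          (-1) * contourIntegral γ (fun z => ((b ::ₘ v).map fun μ => (z - μ)⁻¹).prod)) := by
      rw [← contourIntegral_const_mul, ← hγ.contourIntegral_add (continuousOn_prod_inv _ hav)
        (show ContinuousOn (fun z => (-1) * _) _ from
          continuousOn_const.mul (continuousOn_prod_inv _ hbv)) hU,
        ← contourIntegral_const_mul]
      refine contourIntegral_congr fun t ht => ?_
      have h1 : γ t - a ≠ 0 := fun h => hS t ht (by rwa [sub_eq_zero.1 h])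
      have h2 : γ t - b ≠ 0 := fun h => hS t ht (by rwa [sub_eq_zero.1 h])
      simp only [Multiset.map_cons, Multiset.prod_cons]
      field_simp
      ring
    rw [key]
    rcases Multiset.empty_or_exists_mem v with rfl | ⟨c, hc⟩
    -- Two simple poles remain; their integrals cancel because both winding numbers are 1.
    · have h1 := (hw a ha').trans (hw b hb').symm
      simp only [windingNumber] at h1
      have h2 := mul_left_cancel₀ (by simp [Real.pi_ne_zero]) h1
      simp [h2]
    · have hpos : 0 < v.card := Multiset.card_pos_iff_exists_mem.2 ⟨c, hc⟩
      rw [ih (a ::ₘ v) (Multiset.cons_lt_cons a (Multiset.lt_cons_self v b)) hav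
          (by rw [Multiset.card_cons]; omega),
        ih (b ::ₘ v) (Multiset.lt_cons_self _ _) hbv (by rw [Multiset.card_cons]; omega)]
      simp
  · push Not at hall
    obtain ⟨a, ha⟩ := Multiset.card_pos_iff_exists_mem.1 (by omega : 0 < s.card)
    obtain ⟨m, hm⟩ := Nat.exists_eq_add_of_le' hcard
    have hrep : s = Multiset.replicate (m + 2) a :=
      Multiset.eq_replicate.2 ⟨hm, fun b hb => hall b hb a ha⟩
    -- A single pole of order `m + 2 ≥ 2` has an explicit primitive.
    have hF : ∀ z ∈ Sᶜ, HasDerivAt (fun z => -((m : ℂ) + 1)⁻¹ * ((z - a)⁻¹) ^ (m + 1))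
        ((s.map fun μ => (z - μ)⁻¹).prod) z := by
      intro z hz
      have hza : z - a ≠ 0 := fun h => hz (by rw [sub_eq_zero.1 h]; exact hs a ha)
      have h1 := ((((hasDerivAt_id z).sub_const a).inv hza).pow (m + 1)).const_mul
        (-((m : ℂ) + 1)⁻¹)
      convert! h1 using 1
      have hm1 : (m : ℂ) + 1 ≠ 0 := by exact_mod_cast m.succ_ne_zero
      rw [hrep]
      simp only [Multiset.map_replicate, Multiset.prod_replicate, id]
      push_cast
      simp only [Pi.inv_apply]
      field_simp
      rw [pow_add, mul_comm, mul_assoc, one_div, ← mul_pow, inv_mul_cancel₀ hza, one_pow, mul_one]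
    exact hγ.contourIntegral_eq_zero (continuousOn_prod_inv s hs) hF hU

theorem IsDunfordContour.notMem_spectrum (h : IsDunfordContour X γ) (t : ℝ)
    (ht : t ∈ Icc (0 : ℝ) 1) : γ t ∉ spectrum ℂ X :=
  fun h' => h' (h.mem_resolventSet t ht)

/-- Multiply `z - μ = (z - X) + (X - μ)` by the resolvent. Each use trades a scalar factor `(z -
μ)⁻¹` for a matrix factor `X - μ`. -/
theorem resolvent_eq {μ z : ℂ} (hz : z ∈ resolventSet ℂ X) (hne : z ≠ μ) :
    (z • (1 : Matrix (Fin n) (Fin n) ℂ) - X)⁻¹ =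
      (z - μ)⁻¹ • 1 + (z - μ)⁻¹ • ((X - μ • 1) * (z • (1 : Matrix (Fin n) (Fin n) ℂ) - X)⁻¹) := by
  have hu := (Matrix.isUnit_iff_isUnit_det _).1 (isUnit_smul_one_sub hz)
  have hz' : z - μ ≠ 0 := sub_ne_zero.2 hne
  rw [← smul_add, eq_inv_smul_iff₀ hz']
  nth_rewrite 2 [← Matrix.mul_nonsing_inv _ hu]
  rw [← add_mul, sub_add_sub_cancel, ← sub_smul, smul_mul_assoc, one_mul]

theorem continuousOn_mul_resolvent_apply (Y : Matrix (Fin n) (Fin n) ℂ) (i j : Fin n) :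
    ContinuousOn (fun z : ℂ => (Y * (z • (1 : Matrix (Fin n) (Fin n) ℂ) - X)⁻¹) i j)
      (resolventSet ℂ X) := by
  have h : ContinuousOn (fun z : ℂ => Y * (z • (1 : Matrix (Fin n) (Fin n) ℂ) - X)⁻¹)
      (resolventSet ℂ X) := continuousOn_const.mul continuousOn_resolvent
  exact (continuous_apply_apply i j).comp_continuousOn h

/-- A telescoping argument: if `Y` is killed by a product of factors `X - μ` with `μ` in the
spectrum, then `Y (z - X)⁻¹`, divided by at least one factor `z - μ`, has integral zero. -/
theorem IsDunfordContour.contourIntegral_prod_inv_mul_resolvent (h : IsDunfordContour X γ)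
    (i j : Fin n) (l : List ℂ) (hl : ∀ μ ∈ l, μ ∈ spectrum ℂ X) (s : Multiset ℂ)
    (hs : ∀ μ ∈ s, μ ∈ spectrum ℂ X) (hcard : 1 ≤ s.card) (Y : Matrix (Fin n) (Fin n) ℂ)
    (hY : Y * (l.map fun μ => X - μ • 1).prod = 0) :
    contourIntegral γ (fun z => (s.map fun μ => (z - μ)⁻¹).prod *
      (Y * (z • (1 : Matrix (Fin n) (Fin n) ℂ) - X)⁻¹) i j) = 0 := by
  induction l generalizing s Y with
  | nil =>
    rw [List.map_nil, List.prod_nil, mul_one] at hY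
    simp [hY, contourIntegral]
  | cons μ l ih =>
    have hμ := hl μ List.mem_cons_self
    have hs' : ∀ ν ∈ μ ::ₘ s, ν ∈ spectrum ℂ X := fun ν hν => by
      rcases Multiset.mem_cons.1 hν with rfl | hν
      exacts [hμ, hs ν hν]
    -- Expanding the resolvent at `μ` gives a scalar term with at least two poles, and a term where
    -- `Y` has absorbed `X - μ`, to which the shorter list applies.
    have h1 := contourIntegral_prod_inv_eq_zero h.isClosedContour h.notMem_spectrum
      h.winding_eq_one (μ ::ₘ s) hs' (by rw [Multiset.card_cons]; omega)
    have h2 := ih (fun ν hν => hl ν (List.mem_cons_of_mem μ hν)) (μ ::ₘ s) hs'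
      (by rw [Multiset.card_cons]; omega) (Y * (X - μ • 1))
      (by rw [mul_assoc, ← List.prod_cons, ← List.map_cons (f := fun μ : ℂ => X - μ • 1), hY])
    have hc := continuousOn_prod_inv (μ ::ₘ s) hs'
    have hsp : (spectrum ℂ X)ᶜ = resolventSet ℂ X := compl_compl _
    rw [hsp] at hc
    have h3 := h.isClosedContour.contourIntegral_add (U := resolventSet ℂ X)
      (f := fun z => Y i j * ((μ ::ₘ s).map fun μ => (z - μ)⁻¹).prod)
      (g := fun z => ((μ ::ₘ s).map fun μ => (z - μ)⁻¹).prod *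
        (Y * (X - μ • 1) * (z • (1 : Matrix (Fin n) (Fin n) ℂ) - X)⁻¹) i j)
      (continuousOn_const.mul hc) (hc.mul (continuousOn_mul_resolvent_apply _ i j))
      h.mem_resolventSet
    rw [contourIntegral_const_mul, h1, h2, mul_zero, add_zero] at h3
    rw [← h3]
    refine contourIntegral_congr fun t ht => ?_
    have hne : γ t ≠ μ := fun h' => h.notMem_spectrum t ht (h' ▸ hμ)
    conv_lhs => rw [resolvent_eq (h.mem_resolventSet t ht) hne]
    simp only [mul_add, mul_smul_comm, mul_one, Matrix.add_apply, Matrix.smul_apply, smul_eq_mul,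
      Multiset.map_cons, Multiset.prod_cons, mul_assoc]
    ring

theorem prod_roots_charpoly_eq_zero :
    (X.charpoly.roots.toList.map fun μ => X - μ • (1 : Matrix (Fin n) (Fin n) ℂ)).prod = 0 := by
  have h := Matrix.aeval_self_charpoly X
  rw [(IsAlgClosed.splits X.charpoly).eq_prod_roots_of_monic X.charpoly_monic,
    ← Multiset.coe_toList X.charpoly.roots, Multiset.map_coe, Multiset.prod_coe, map_list_prod,
    List.map_map] at h
  rw [← h]
  congr 2
  funext μ
  simp [Algebra.algebraMap_eq_smul_one]

/-- Expand the resolvent once at an eigenvalue: the scalar term gives `2πi` by the winding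
condition, and Cayley–Hamilton in factored form lets the telescoping argument kill the rest. -/
theorem IsDunfordContour.contourIntegral_resolvent (h : IsDunfordContour X γ) (i j : Fin n) :
    contourIntegral γ (fun z => (z • (1 : Matrix (Fin n) (Fin n) ℂ) - X)⁻¹ i j) =
      2 * Real.pi * Complex.I * (1 : Matrix (Fin n) (Fin n) ℂ) i j := by
  have hroots : ∀ μ ∈ X.charpoly.roots.toList, μ ∈ spectrum ℂ X := fun μ hμ =>
    mem_spectrum_of_mem_roots (Multiset.mem_toList.1 hμ)
  -- The index `i` forces `n > 0`, so an eigenvalue exists.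
  have hcard : 0 < X.charpoly.roots.card := by
    rw [← (IsAlgClosed.splits X.charpoly).natDegree_eq_card_roots, X.charpoly_natDegree_eq_dim,
      Fintype.card_fin]
    exact i.pos
  obtain ⟨μ, hμ⟩ := Multiset.card_pos_iff_exists_mem.1 hcard
  have hμ := mem_spectrum_of_mem_roots hμ
  have hs : ∀ ν ∈ ({μ} : Multiset ℂ), ν ∈ spectrum ℂ X := fun ν hν => by
    rwa [Multiset.mem_singleton.1 hν]
  have h2 := h.contourIntegral_prod_inv_mul_resolvent i j _ hroots {μ} hs (by simp) (X - μ • 1)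
    (by rw [prod_roots_charpoly_eq_zero, mul_zero])
  have h1 := h.winding_eq_one μ hμ
  rw [windingNumber, inv_mul_eq_one₀ (by simp [Real.pi_ne_zero])] at h1
  have hc := continuousOn_prod_inv {μ} hs
  rw [show (spectrum ℂ X)ᶜ = resolventSet ℂ X from compl_compl _] at hc
  simp only [Multiset.map_singleton, Multiset.prod_singleton] at hc h2
  have h3 := h.isClosedContour.contourIntegral_add (U := resolventSet ℂ X)
    (f := fun z => (1 : Matrix (Fin n) (Fin n) ℂ) i j * (z - μ)⁻¹)
    (g := fun z => (z - μ)⁻¹ *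
      ((X - μ • 1) * (z • (1 : Matrix (Fin n) (Fin n) ℂ) - X)⁻¹) i j)
    (continuousOn_const.mul hc) (hc.mul (continuousOn_mul_resolvent_apply _ i j))
    h.mem_resolventSet
  rw [contourIntegral_const_mul, h2, ← h1, add_zero, mul_comm] at h3
  rw [← h3]
  refine contourIntegral_congr fun t ht => ?_
  have hne : γ t ≠ μ := fun h' => h.notMem_spectrum t ht (h' ▸ hμ)
  conv_lhs => rw [resolvent_eq (h.mem_resolventSet t ht) hne]
  simp only [Matrix.add_apply, Matrix.smul_apply, smul_eq_mul]
  ring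

theorem IsDunfordContour.contourIntegral_mul_resolvent (h : IsDunfordContour X γ)
    (Y : Matrix (Fin n) (Fin n) ℂ) (i j : Fin n) :
    contourIntegral γ (fun z => (Y * (z • (1 : Matrix (Fin n) (Fin n) ℂ) - X)⁻¹) i j) =
      2 * Real.pi * Complex.I * Y i j := by
  have hcont : ∀ k, ContinuousOn (fun z : ℂ => Y i k *
      (z • (1 : Matrix (Fin n) (Fin n) ℂ) - X)⁻¹ k j) (resolventSet ℂ X) := fun k =>
    continuousOn_const.mul ((continuous_apply_apply k j).comp_continuousOn continuousOn_resolvent)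
  have hsum : contourIntegral γ (fun z => ∑ k, Y i k *
      (z • (1 : Matrix (Fin n) (Fin n) ℂ) - X)⁻¹ k j) = ∑ k, contourIntegral γ (fun z => Y i k *
      (z • (1 : Matrix (Fin n) (Fin n) ℂ) - X)⁻¹ k j) := by
    simp only [contourIntegral, Finset.sum_mul]
    exact intervalIntegral.integral_finsetSum fun k _ =>
      h.isClosedContour.intervalIntegrable (hcont k) h.mem_resolventSet
  simp only [Matrix.mul_apply]
  rw [hsum]
  conv_rhs => rw [← mul_one Y, Matrix.mul_apply, Finset.mul_sum]
  refine Finset.sum_congr rfl fun k _ => ?_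
  rw [contourIntegral_const_mul, h.contourIntegral_resolvent k j]
  ring

/-! ### Dunford integrals as values of the calculus -/

/-- The Dunford integral computes the holomorphic functional calculus. -/
theorem HasHolCalc.dunfordIntegral_eq {f : ℂ → ℂ} {M : Matrix (Fin n) (Fin n) ℂ}
    (hf : HasHolCalc f X M) (h : IsDunfordContour X γ) : dunfordIntegral f X γ = M := by
  obtain ⟨P, g, hg, hP, rfl⟩ := hf
  obtain ⟨S, hS, hS'⟩ := exists_eval_smul_sub_aeval (X := X) P
  ext i j
  rw [dunfordIntegral, Matrix.of_apply, inv_mul_eq_iff_eq_mul₀ (by simp [Real.pi_ne_zero])]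
  -- The integrand differs from `P(X)` times the resolvent by this function, holomorphic on the
  -- whole slit plane, even at the eigenvalues.
  have hdiff : DifferentiableOn ℂ (fun z => S z i j + g z *
      (z • (1 : Matrix (Fin n) (Fin n) ℂ) - X).adjugate i j) Complex.slitPlane :=
    (hS i j).differentiableOn.add (hg.mul (differentiable_adjugate_smul_one_sub i j).differentiableOn)
  have hU : ∀ t ∈ Icc (0 : ℝ) 1, γ t ∈ resolventSet ℂ X ∩ Complex.slitPlane := fun t ht =>
    ⟨h.mem_resolventSet t ht, h.mem_slitPlane t ht⟩
  have h1 := h.isClosedContour.contourIntegral_add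
    ((continuousOn_mul_resolvent_apply (Polynomial.aeval X P) i j).mono inter_subset_left)
    (hdiff.continuousOn.mono inter_subset_right) hU
  rw [h.isClosedContour.contourIntegral_eq_zero_of_differentiableOn h.mem_slitPlane hdiff,
    add_zero] at h1
  rw [← h.contourIntegral_mul_resolvent, ← h1]
  refine contourIntegral_congr fun t ht => ?_
  have hu := (Matrix.isUnit_iff_isUnit_det _).1 (isUnit_smul_one_sub (h.mem_resolventSet t ht))
  have hadj : (γ t • (1 : Matrix (Fin n) (Fin n) ℂ) - X).adjugate =
      X.charpoly.eval (γ t) • (γ t • (1 : Matrix (Fin n) (Fin n) ℂ) - X)⁻¹ := by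
    rw [Matrix.inv_def, Ring.inverse_eq_inv', det_smul_one_sub,
      smul_inv_smul₀ (charpoly_eval_ne_zero (h.mem_resolventSet t ht))]
  have hPS : P.eval (γ t) • (γ t • (1 : Matrix (Fin n) (Fin n) ℂ) - X)⁻¹ =
      Polynomial.aeval X P * (γ t • (1 : Matrix (Fin n) (Fin n) ℂ) - X)⁻¹ + S (γ t) := by
    have := congrArg (· * (γ t • (1 : Matrix (Fin n) (Fin n) ℂ) - X)⁻¹) (hS' (γ t))
    simp only [sub_mul _ (Polynomial.aeval X P), smul_mul_assoc, one_mul] at this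
    rw [mul_assoc, Matrix.mul_nonsing_inv _ hu, mul_one] at this
    rw [← this]
    abel
  have hij := congrFun (congrFun hPS i) j
  simp only [Matrix.smul_apply, Matrix.add_apply, smul_eq_mul] at hij
  rw [hP _ (h.mem_slitPlane t ht), hadj, add_mul, hij, Matrix.smul_apply, smul_eq_mul]
  ring

theorem dunfordPow_wellDefined_and_eq {s : ℝ} {M : Matrix (Fin n) (Fin n) ℂ}
    (hX : ∃ γ, IsDunfordContour X γ) (hM : HasHolCalc (fun z => z ^ (s : ℂ)) X M) :
    DunfordPowWellDefined X s ∧ dunfordPow X s = M := by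
  have h : dunfordPow X s = M := by
    rw [dunfordPow, dif_pos hX]
    exact hM.dunfordIntegral_eq hX.choose_spec
  exact ⟨⟨hX, fun γ hγ => by rw [h, hM.dunfordIntegral_eq hγ]⟩, h⟩

/-! ### Existence of an admissible contour -/

/-- A finite subset of the right half-plane is enclosed by a circle in the right half-plane. -/
theorem exists_ball_of_finite {S : Set ℂ} (hS : S.Finite) (hre : ∀ w ∈ S, 0 < w.re) :
    ∃ ρ R : ℝ, 0 < R ∧ R < ρ ∧ ∀ w ∈ S, w ∈ Metric.ball (ρ : ℂ) R := by
  -- This inequality says `|w - ρ|² < ρ² - 1`; it holds for large `ρ` because `Re w > 0`.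
  have h1 : ∀ w ∈ S, ∀ᶠ ρ : ℝ in Filter.atTop, ‖w‖ ^ 2 + 1 < 2 * ρ * w.re := by
    intro w hw
    filter_upwards [Filter.eventually_gt_atTop ((‖w‖ ^ 2 + 1) / (2 * w.re))] with ρ hρ
    rw [div_lt_iff₀ (by linarith [hre w hw])] at hρ
    linarith
  obtain ⟨ρ, hρ, h1ρ⟩ := ((Filter.eventually_all_finite hS).2 h1 |>.and
    (Filter.eventually_gt_atTop (1 : ℝ))).exists
  have hpos : 0 < ρ ^ 2 - 1 := by nlinarith
  refine ⟨ρ, √(ρ ^ 2 - 1), Real.sqrt_pos.2 hpos, ?_, fun w hw => ?_⟩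
  · rw [Real.sqrt_lt hpos.le (by linarith)]
    linarith
  · rw [mem_ball_iff_norm]
    refine Real.lt_sqrt_of_sq_lt ?_
    have := hρ w hw
    rw [Complex.sq_norm, Complex.normSq_apply] at this ⊢
    simp only [Complex.sub_re, Complex.ofReal_re, Complex.sub_im, Complex.ofReal_im, sub_zero]
    nlinarith

/-- The square of the circle of radius `R` around `ρ`, parametrized by `[0, 1]`. -/
noncomputable def squaredCircle (ρ R t : ℝ) : ℂ := circleMap ρ R (2 * Real.pi * t) ^ 2

theorem contDiff_squaredCircle (ρ R : ℝ) : ContDiff ℝ 1 (squaredCircle ρ R) :=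
  ((contDiff_circleMap (ρ : ℂ) R).comp (contDiff_const.mul contDiff_id)).pow 2

theorem deriv_squaredCircle (ρ R t : ℝ) : deriv (squaredCircle ρ R) t =
    2 * circleMap ρ R (2 * Real.pi * t) *
      (2 * Real.pi * deriv (circleMap ρ R) (2 * Real.pi * t)) := by
  have h1 : HasDerivAt (fun t : ℝ => 2 * Real.pi * t) (2 * Real.pi) t := by
    simpa using (hasDerivAt_id t).const_mul (2 * Real.pi)
  have h2 := ((hasDerivAt_circleMap (ρ : ℂ) R (2 * Real.pi * t)).scomp t h1).pow 2
  have h3 := h2.deriv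
  simp only [Function.comp_def, Complex.real_smul] at h3
  rw [deriv_circleMap]
  refine Eq.trans ?_ (h3.trans ?_)
  · rfl
  · simp

theorem re_circleMap_pos {ρ R : ℝ} (hR : 0 < R) (hρ : R < ρ) (θ : ℝ) :
    0 < (circleMap (ρ : ℂ) R θ).re := by
  have h1 := circleMap_mem_sphere (ρ : ℂ) hR.le θ
  rw [mem_sphere_iff_norm] at h1
  have h2 := (abs_le.1 (Complex.abs_re_le_norm (circleMap (ρ : ℂ) R θ - ρ))).1
  rw [h1, Complex.sub_re, Complex.ofReal_re] at h2
  linarith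

/-- Under `ζ = z²` the form `dζ / (ζ - w²)` becomes `((z - w)⁻¹ + (z + w)⁻¹) dz`, and the pole `-w`
lies outside the disc. -/
theorem windingNumber_squaredCircle {ρ R : ℝ} (hR : 0 < R) (hρ : R < ρ) {w : ℂ}
    (hw : w ∈ Metric.ball (ρ : ℂ) R) (hwre : 0 < w.re) :
    windingNumber (squaredCircle ρ R) (w ^ 2) = 1 := by
  have hne : ∀ θ, circleMap (ρ : ℂ) R θ - w ≠ 0 := fun θ h =>
    circleMap_ne_mem_ball hw θ (sub_eq_zero.1 h)
  have hne' : ∀ θ, circleMap (ρ : ℂ) R θ + w ≠ 0 := fun θ h => by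
    have := congrArg Complex.re h
    have := re_circleMap_pos hR hρ θ
    simp at *
    linarith
  have h1 : ∮ z in C((ρ : ℂ), R), (z - w)⁻¹ = 2 * Real.pi * Complex.I :=
    circleIntegral.integral_sub_inv_of_mem_ball hw
  have h2 : ∮ z in C((ρ : ℂ), R), (z + w)⁻¹ = 0 := by
    have hne2 : ∀ z ∈ Metric.closedBall (ρ : ℂ) R, z + w ≠ 0 := fun z hz h => by
      rw [mem_closedBall_iff_norm] at hz
      have h2 := (abs_le.1 (Complex.abs_re_le_norm (z - ρ))).1
      have := congrArg Complex.re h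
      simp at *
      linarith
    refine Complex.circleIntegral_eq_zero_of_differentiable_on_off_countable hR.le
      countable_empty (ContinuousOn.inv₀ (by fun_prop) hne2) fun z hz => ?_
    have := hne2 z (Metric.ball_subset_closedBall hz.1)
    fun_prop (disch := assumption)
  have hc1 : CircleIntegrable (fun z => (z - w)⁻¹) ρ R := by
    rw [circleIntegrable_def]
    exact Continuous.intervalIntegrable (Continuous.inv₀ (by fun_prop) hne) _ _
  have hc2 : CircleIntegrable (fun z => (z + w)⁻¹) ρ R := by
    rw [circleIntegrable_def]
    exact Continuous.intervalIntegrable (Continuous.inv₀ (by fun_prop) hne') _ _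
  have h3 := circleIntegral.integral_add hc1 hc2
  rw [h1, h2, add_zero] at h3
  rw [windingNumber, inv_mul_eq_one₀ (by simp [Real.pi_ne_zero]), ← h3, circleIntegral,
    contourIntegral]
  have h4 := intervalIntegral.smul_integral_comp_mul_left (a := 0) (b := 1) (fun θ =>
    deriv (circleMap (ρ : ℂ) R) θ • ((circleMap (ρ : ℂ) R θ - w)⁻¹ + (circleMap (ρ : ℂ) R θ + w)⁻¹))
    (2 * Real.pi)
  rw [mul_zero, mul_one] at h4
  rw [← h4, ← intervalIntegral.integral_smul]
  refine intervalIntegral.integral_congr fun t _ => ?_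
  simp only [deriv_squaredCircle, squaredCircle, smul_eq_mul, Complex.real_smul]
  have e1 := hne (2 * Real.pi * t)
  have e2 := hne' (2 * Real.pi * t)
  rw [sq_sub_sq]
  push_cast
  field_simp
  ring

/-- A circle in the right half-plane around the principal roots of the eigenvalues is squared.
Global smoothness is kept for the Fubini argument. -/
theorem exists_contDiff_isDunfordContour (hX : spectrum ℂ X ⊆ Complex.slitPlane) :
    ∃ γ, ContDiff ℝ 1 γ ∧ IsDunfordContour X γ := by
  have hfin : (spectrum ℂ X).Finite := Matrix.finite_spectrum X
  obtain ⟨ρ, R, hR, hρ, hb⟩ := exists_ball_of_finite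
    (hfin.image fun z => Complex.exp (Complex.log z / 2)) (by
      rintro _ ⟨z, hz, rfl⟩
      exact re_exp_log_div_two_pos (hX hz))
  have hb' : ∀ μ ∈ spectrum ℂ X, ∃ w ∈ Metric.ball (ρ : ℂ) R, 0 < w.re ∧ w ^ 2 = μ := fun μ hμ =>
    ⟨_, hb _ (mem_image_of_mem _ hμ), re_exp_log_div_two_pos (hX hμ),
      exp_log_div_two_sq (Complex.slitPlane_ne_zero (hX hμ))⟩
  refine ⟨squaredCircle ρ R, contDiff_squaredCircle ρ R, ⟨?_, 1, fun i => i, ?_, ?_, ?_, ?_⟩,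
    fun t _ => sq_mem_slitPlane (re_circleMap_pos hR hρ _), fun t _ => ?_, fun μ hμ => ?_⟩
  · have := periodic_circleMap (ρ : ℂ) R 0
    simp only [squaredCircle, mul_zero, mul_one]
    rw [← this, zero_add]
  · exact Nat.mono_cast
  · simp
  · simp
  · exact fun i _ => (contDiff_squaredCircle ρ R).contDiffOn
  · by_contra h
    obtain ⟨w, hw, hwre, hsq⟩ := hb' _ h
    rcases sq_eq_sq_iff_eq_or_eq_neg.1 hsq.symm with h1 | h1
    · exact circleMap_ne_mem_ball hw _ h1
    · have h2 := congrArg Complex.re h1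
      have := re_circleMap_pos hR hρ (2 * Real.pi * t)
      rw [h2, Complex.neg_re] at this
      linarith
  · obtain ⟨w, hw, hwre, rfl⟩ := hb' _ hμ
    exact windingNumber_squaredCircle hR hρ hw hwre

/-! ### The scalar integral formula for the principal power -/

theorem add_ofReal_mem_slitPlane {z : ℂ} (hz : z ∈ Complex.slitPlane) {t : ℝ} (ht : 0 ≤ t) :
    z + t ∈ Complex.slitPlane := by
  rw [Complex.mem_slitPlane_iff] at hz ⊢
  rcases hz with h | h
  · left; simpa using add_pos_of_pos_of_nonneg h ht
  · right; simpa using h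

/-- Resolvents of points in a compact part of the slit plane decay uniformly on `(-∞, 0]`. -/
theorem exists_norm_add_inv_le {K : Set ℂ} (hK : IsCompact K) (hs : K ⊆ Complex.slitPlane) :
    ∃ C : ℝ, 0 ≤ C ∧ ∀ z ∈ K, ∀ t : ℝ, 0 ≤ t → ‖(z + t)⁻¹‖ ≤ C * (1 + t)⁻¹ := by
  -- With `s = t / (1 + t)` one has `z + t = (1 + t)(z + s (1 - z))`; the last factor is on the
  -- segment from `z` to 1, inside the slit plane, so compactness bounds its inverse.
  have hne : ∀ p ∈ K ×ˢ Icc (0 : ℝ) 1, p.1 + (p.2 : ℂ) * (1 - p.1) ≠ 0 := by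
    rintro ⟨z, s⟩ ⟨hz, hs0, hs1⟩
    have h := Complex.starConvex_one_slitPlane (hs hz) hs0 (sub_nonneg.2 hs1) (by ring)
    have h := Complex.slitPlane_ne_zero h
    convert h using 1
    simp only [Complex.real_smul]
    push_cast
    ring
  have hcont : ContinuousOn (fun p : ℂ × ℝ => (p.1 + (p.2 : ℂ) * (1 - p.1))⁻¹)
      (K ×ˢ Icc (0 : ℝ) 1) :=
    ContinuousOn.inv₀ (by fun_prop) hne
  obtain ⟨C, hC⟩ := (hK.prod isCompact_Icc).exists_bound_of_continuousOn hcont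
  refine ⟨max C 0, le_max_right _ _, fun z hz t ht => ?_⟩
  have h1t : 0 < 1 + t := by linarith
  have hmem : t / (1 + t) ∈ Icc (0 : ℝ) 1 :=
    ⟨by positivity, (div_le_one h1t).2 (by linarith)⟩
  have h1 := (hC (z, t / (1 + t)) ⟨hz, hmem⟩).trans (le_max_left C 0)
  have h1c : (1 + t : ℂ) ≠ 0 := by exact_mod_cast h1t.ne'
  have h2 : (z + t)⁻¹ = (z + ((t / (1 + t) : ℝ) : ℂ) * (1 - z))⁻¹ * ((1 + t : ℝ) : ℂ)⁻¹ := by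
    rw [← mul_inv]
    congr 1
    push_cast
    field_simp
    ring
  rw [h2, norm_mul, norm_inv ((1 + t : ℝ) : ℂ), Complex.norm_of_nonneg h1t.le]
  exact mul_le_mul_of_nonneg_right h1 (by positivity)

theorem image_div_one_add_Ioi : (fun t : ℝ => t / (1 + t)) '' Ioi 0 = Ioo 0 1 := by
  ext x
  constructor
  · rintro ⟨t, ht, rfl⟩
    have ht : 0 < t := ht
    exact ⟨by positivity, (div_lt_one (by linarith)).2 (by linarith)⟩
  · rintro ⟨h0, h1⟩
    have : 1 - x ≠ 0 := by linarith
    refine ⟨x / (1 - x), div_pos h0 (by linarith), ?_⟩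
    field_simp
    ring

theorem hasDerivAt_div_one_add {t : ℝ} (ht : 0 < t) :
    HasDerivAt (fun t : ℝ => t / (1 + t)) (((1 + t) ^ 2)⁻¹) t := by
  have h := (hasDerivAt_id t).div ((hasDerivAt_id t).const_add 1) (by simp; linarith)
  convert! h using 1
  simp only [id]
  field_simp
  ring

theorem injOn_div_one_add : InjOn (fun t : ℝ => t / (1 + t)) (Ioi 0) := by
  intro s hs t ht h
  have hs : 0 < s := hs
  have ht : 0 < t := ht
  simp only at h
  rw [div_eq_div_iff (by linarith) (by linarith)] at h
  linarith

/-- The substitution `x = t / (1 + t)` in the Beta integral `B(l, 1 - l)`, which Euler's reflection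
formula evaluates. -/
theorem abs_deriv_smul_beta_integrand {l t : ℝ} (ht : 0 < t) :
    |((1 + t) ^ 2)⁻¹| • (((t / (1 + t) : ℝ) : ℂ) ^ ((l : ℂ) - 1) *
      (1 - ((t / (1 + t) : ℝ) : ℂ)) ^ ((1 - (l : ℂ)) - 1)) =
      ((t ^ (l - 1) : ℝ) : ℂ) * (1 + (t : ℂ))⁻¹ := by
  have h1t : 0 < 1 + t := by linarith
  have h1 : 1 - ((t / (1 + t) : ℝ) : ℂ) = (((1 + t)⁻¹ : ℝ) : ℂ) := by
    have : (1 + t : ℂ) ≠ 0 := by exact_mod_cast h1t.ne'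
    push_cast
    field_simp
    ring
  have h2 : (l : ℂ) - 1 = ((l - 1 : ℝ) : ℂ) := by push_cast; ring
  have h3 : (1 - (l : ℂ)) - 1 = ((-l : ℝ) : ℂ) := by push_cast; ring
  rw [h1, h2, h3, ← Complex.ofReal_cpow (by positivity), ← Complex.ofReal_cpow (by positivity),
    Complex.real_smul, abs_of_pos (by positivity)]
  have h4 : ((1 + t) ^ 2)⁻¹ * ((t / (1 + t)) ^ (l - 1) * ((1 + t)⁻¹) ^ (-l)) =
      t ^ (l - 1) * (1 + t)⁻¹ := by
    rw [Real.div_rpow ht.le h1t.le, Real.inv_rpow h1t.le, Real.rpow_neg h1t.le, inv_inv,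
      Real.rpow_sub_one h1t.ne']
    have := (Real.rpow_pos_of_pos h1t l).ne'
    field_simp
  rw [← Complex.ofReal_mul, ← Complex.ofReal_mul, h4]
  push_cast
  rfl

variable {l : ℝ}

theorem integrableOn_rpow_mul_one_add_inv (hl0 : 0 < l) (hl1 : l < 1) :
    IntegrableOn (fun t : ℝ => ((t ^ (l - 1) : ℝ) : ℂ) * (1 + (t : ℂ))⁻¹) (Ioi 0) := by
  have h := Complex.betaIntegral_convergent (u := l) (v := 1 - l) (by simpa) (by simpa)
  rw [intervalIntegrable_iff_integrableOn_Ioo_of_le zero_le_one, ← image_div_one_add_Ioi,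
    integrableOn_image_iff_integrableOn_abs_deriv_smul measurableSet_Ioi
      (fun t ht => (hasDerivAt_div_one_add ht).hasDerivWithinAt) injOn_div_one_add] at h
  exact h.congr_fun (fun t ht => abs_deriv_smul_beta_integrand ht) measurableSet_Ioi

theorem integral_rpow_mul_one_add_inv (hl0 : 0 < l) (hl1 : l < 1) :
    ∫ t in Ioi (0 : ℝ), ((t ^ (l - 1) : ℝ) : ℂ) * (1 + (t : ℂ))⁻¹ =
      ((Real.pi / Real.sin (l * Real.pi) : ℝ) : ℂ) := by
  have h := Complex.Gamma_mul_Gamma_eq_betaIntegral (s := l) (t := 1 - l) (by simpa) (by simpa)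
  rw [Complex.Gamma_mul_Gamma_one_sub, add_sub_cancel, Complex.Gamma_one, one_mul,
    Complex.betaIntegral, intervalIntegral.integral_of_le zero_le_one, integral_Ioc_eq_integral_Ioo,
    ← image_div_one_add_Ioi, integral_image_eq_integral_abs_deriv_smul measurableSet_Ioi
      (fun t ht => (hasDerivAt_div_one_add ht).hasDerivWithinAt) injOn_div_one_add,
    setIntegral_congr_fun measurableSet_Ioi fun t ht => abs_deriv_smul_beta_integrand ht] at h
  rw [← h, mul_comm l]
  push_cast
  rfl

theorem integrableOn_rpow_mul_one_add_inv_real (hl0 : 0 < l) (hl1 : l < 1) :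
    IntegrableOn (fun t : ℝ => t ^ (l - 1) * (1 + t)⁻¹) (Ioi 0) := by
  have h : IntegrableOn (fun t : ℝ => RCLike.re (((t ^ (l - 1) : ℝ) : ℂ) * (1 + (t : ℂ))⁻¹))
      (Ioi 0) := (integrableOn_rpow_mul_one_add_inv hl0 hl1).re
  refine h.congr_fun (fun t _ => ?_) measurableSet_Ioi
  have : ((t ^ (l - 1) : ℝ) : ℂ) * (1 + (t : ℂ))⁻¹ = ((t ^ (l - 1) * (1 + t)⁻¹ : ℝ) : ℂ) := by
    push_cast; rfl
  simp only [this]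
  exact RCLike.ofReal_re (K := ℂ) _

theorem continuousOn_rpow_ofReal : ContinuousOn (fun t : ℝ => ((t ^ (l - 1) : ℝ) : ℂ)) (Ioi 0) :=
  Complex.continuous_ofReal.comp_continuousOn
    (continuousOn_id.rpow_const fun _ ht => Or.inl (ne_of_gt ht))

theorem continuousOn_add_ofReal_inv {z : ℂ} (hz : z ∈ Complex.slitPlane) :
    ContinuousOn (fun t : ℝ => (z + t)⁻¹) (Ioi 0) :=
  ContinuousOn.inv₀ (by fun_prop) fun _ ht =>
    Complex.slitPlane_ne_zero (add_ofReal_mem_slitPlane hz (le_of_lt ht))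

/-- The Stieltjes transform of `t ^ (l - 1)` is holomorphic on the slit plane. -/
theorem differentiableOn_stieltjes (hl0 : 0 < l) (hl1 : l < 1) :
    DifferentiableOn ℂ (fun z : ℂ => ∫ t in Ioi (0 : ℝ), ((t ^ (l - 1) : ℝ) : ℂ) * (z + t)⁻¹)
      Complex.slitPlane := by
  intro z₀ hz₀
  refine DifferentiableAt.differentiableWithinAt ?_
  obtain ⟨ε, hε, hball⟩ := Metric.nhds_basis_closedBall.mem_iff.1
    (Complex.isOpen_slitPlane.mem_nhds hz₀)
  obtain ⟨C, hC0, hC⟩ := exists_norm_add_inv_le (isCompact_closedBall z₀ ε) hball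
  have hmeas : ∀ z ∈ Complex.slitPlane, AEStronglyMeasurable
      (fun t : ℝ => ((t ^ (l - 1) : ℝ) : ℂ) * (z + t)⁻¹) (volume.restrict (Ioi 0)) := fun z hz =>
    (continuousOn_rpow_ofReal.mul (continuousOn_add_ofReal_inv hz)).aestronglyMeasurable
      measurableSet_Ioi
  have hnorm : ∀ t : ℝ, t ∈ Ioi (0 : ℝ) → ‖((t ^ (l - 1) : ℝ) : ℂ)‖ = t ^ (l - 1) := fun t ht =>
    Complex.norm_of_nonneg (Real.rpow_nonneg (le_of_lt ht) _)
  have hint := integrableOn_rpow_mul_one_add_inv_real hl0 hl1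
  refine (hasDerivAt_integral_of_dominated_loc_of_deriv_le
    (F' := fun z t => ((t ^ (l - 1) : ℝ) : ℂ) * (-((z + t)⁻¹ ^ 2)))
    (bound := fun t => C ^ 2 * (t ^ (l - 1) * (1 + t)⁻¹))
    (Metric.closedBall_mem_nhds z₀ hε) ?_ ?_ ?_ ?_ (hint.const_mul _) ?_).2.differentiableAt
  · filter_upwards [Complex.isOpen_slitPlane.mem_nhds hz₀] with z hz using hmeas z hz
  · refine (hint.const_mul C).mono' (hmeas z₀ hz₀) ?_
    filter_upwards [ae_restrict_mem measurableSet_Ioi] with t ht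
    rw [norm_mul, hnorm t ht]
    have := mul_le_mul_of_nonneg_left (hC z₀ (Metric.mem_closedBall_self hε.le) t (le_of_lt ht))
      (Real.rpow_nonneg (le_of_lt ht) (l - 1))
    linarith
  · exact (continuousOn_rpow_ofReal.mul ((continuousOn_add_ofReal_inv hz₀).pow 2).neg
      ).aestronglyMeasurable measurableSet_Ioi
  · filter_upwards [ae_restrict_mem measurableSet_Ioi] with t ht z hz
    have ht : 0 < t := ht
    have h1 := hC z hz t ht.le
    have h2 : (1 + t)⁻¹ ≤ 1 := inv_le_one_of_one_le₀ (by linarith)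
    have h3 : 0 ≤ (1 + t)⁻¹ := by positivity
    rw [norm_mul, hnorm t ht, norm_neg, norm_pow]
    -- One factor `(1 + t)⁻¹ ≤ 1` is dropped, so the same integrable function dominates the
    -- derivative.
    calc t ^ (l - 1) * ‖(z + t)⁻¹‖ ^ 2 ≤ t ^ (l - 1) * (C * (1 + t)⁻¹) ^ 2 := by gcongr
      _ = C ^ 2 * (t ^ (l - 1) * ((1 + t)⁻¹ * (1 + t)⁻¹)) := by ring
      _ ≤ C ^ 2 * (t ^ (l - 1) * ((1 + t)⁻¹ * 1)) := by gcongr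
      _ = _ := by ring
  · filter_upwards [ae_restrict_mem measurableSet_Ioi] with t ht z hz
    have hne := Complex.slitPlane_ne_zero (add_ofReal_mem_slitPlane (hball hz) (le_of_lt ht))
    have h := (((hasDerivAt_id z).add_const (t : ℂ)).inv hne).const_mul ((t ^ (l - 1) : ℝ) : ℂ)
    convert! h using 1
    simp [neg_div]

theorem stieltjes_ofReal (hl0 : 0 < l) (hl1 : l < 1) {x : ℝ} (hx : 0 < x) :
    ∫ t in Ioi (0 : ℝ), ((t ^ (l - 1) : ℝ) : ℂ) * ((x : ℂ) + t)⁻¹ =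
      ((x ^ (l - 1) : ℝ) : ℂ) * ((Real.pi / Real.sin (l * Real.pi) : ℝ) : ℂ) := by
  have h := integral_comp_mul_left_Ioi' (fun t : ℝ => ((t ^ (l - 1) : ℝ) : ℂ) * ((x : ℂ) + t)⁻¹) 0 hx
  rw [mul_zero] at h
  rw [← h, ← integral_rpow_mul_one_add_inv hl0 hl1, ← integral_const_mul, ← integral_smul]
  refine setIntegral_congr_fun measurableSet_Ioi fun t ht => ?_
  have ht : 0 < t := ht
  have hxc : (x : ℂ) ≠ 0 := by exact_mod_cast hx.ne'
  simp only [Real.mul_rpow hx.le ht.le, Complex.real_smul, Complex.ofReal_mul]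
  rw [show (x : ℂ) + x * t = x * (1 + t) by ring, mul_inv]
  field_simp

/-- The principal power `z ^ l` as an integral over `(0, ∞)`. -/
theorem cpow_eq_integral (hl0 : 0 < l) (hl1 : l < 1) {z : ℂ} (hz : z ∈ Complex.slitPlane) :
    z ^ (l : ℂ) = ((Real.sin (l * Real.pi) / Real.pi : ℝ) : ℂ) *
      ∫ t in Ioi (0 : ℝ), ((t ^ (l - 1) : ℝ) : ℂ) * (z * (z + t)⁻¹) := by
  have hd1 : DifferentiableOn ℂ (fun z : ℂ => z ^ (l : ℂ)) Complex.slitPlane := fun w hw =>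
    ((hasDerivAt_id w).cpow_const hw).differentiableAt.differentiableWithinAt
  have hd2 : DifferentiableOn ℂ (fun z : ℂ => ((Real.sin (l * Real.pi) / Real.pi : ℝ) : ℂ) *
      (z * ∫ t in Ioi (0 : ℝ), ((t ^ (l - 1) : ℝ) : ℂ) * (z + t)⁻¹)) Complex.slitPlane :=
    (differentiableOn_id.mul (differentiableOn_stieltjes hl0 hl1)).const_mul _
  have hsin : Real.sin (l * Real.pi) ≠ 0 := by
    refine (Real.sin_pos_of_pos_of_lt_pi (by positivity) ?_).ne'
    nlinarith [Real.pi_pos]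
  have hreal : ∀ x : ℝ, 0 < x → (x : ℂ) ^ (l : ℂ) =
      ((Real.sin (l * Real.pi) / Real.pi : ℝ) : ℂ) *
        ((x : ℂ) * ∫ t in Ioi (0 : ℝ), ((t ^ (l - 1) : ℝ) : ℂ) * ((x : ℂ) + t)⁻¹) := by
    intro x hx
    rw [stieltjes_ofReal hl0 hl1 hx, ← Complex.ofReal_cpow hx.le, ← Complex.ofReal_mul,
      ← Complex.ofReal_mul, ← Complex.ofReal_mul, Real.rpow_sub_one hx.ne']
    congr 1
    have := Real.pi_ne_zero
    field_simp
  -- For the identity theorem, agreement at real points decreasing to 1 suffices.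
  have hfreq : ∃ᶠ z : ℂ in nhdsWithin (1 : ℂ) {1}ᶜ, z ^ (l : ℂ) =
      ((Real.sin (l * Real.pi) / Real.pi : ℝ) : ℂ) *
        (z * ∫ t in Ioi (0 : ℝ), ((t ^ (l - 1) : ℝ) : ℂ) * (z + t)⁻¹) := by
    have ht : Filter.Tendsto (fun x : ℝ => (x : ℂ)) (nhdsWithin (1 : ℝ) (Ioi 1))
        (nhdsWithin (1 : ℂ) {1}ᶜ) := by
      refine tendsto_nhdsWithin_iff.2 ⟨?_, ?_⟩
      · have := (Complex.continuous_ofReal.tendsto 1).mono_left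
          (nhdsWithin_le_nhds (s := Ioi (1 : ℝ)))
        simpa using this
      · filter_upwards [self_mem_nhdsWithin] with x hx
        have hx : 1 < x := hx
        simpa using hx.ne'
    refine ht.frequently (Filter.Eventually.frequently ?_)
    filter_upwards [self_mem_nhdsWithin] with x hx
    exact hreal x (zero_lt_one.trans hx)
  have h := AnalyticOnNhd.eqOn_of_preconnected_of_frequently_eq
    (hd1.analyticOnNhd Complex.isOpen_slitPlane) (hd2.analyticOnNhd Complex.isOpen_slitPlane)
    (Complex.starConvex_one_slitPlane.isPathConnected
      Complex.one_mem_slitPlane).isConnected.isPreconnected Complex.one_mem_slitPlane hfreq hz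
  simp only at h
  rw [h, ← integral_const_mul]
  congr 2
  funext t
  ring

/-! ### The integral formula for matrix powers -/

theorem IsDunfordContour.hasHolCalc_unique (h : IsDunfordContour X γ) {f : ℂ → ℂ}
    {M N : Matrix (Fin n) (Fin n) ℂ} (hM : HasHolCalc f X M) (hN : HasHolCalc f X N) : M = N :=
  (hM.dunfordIntegral_eq h).symm.trans (hN.dunfordIntegral_eq h)

theorem hasHolCalc_one : HasHolCalc (fun _ => 1) X 1 := by
  simpa using hasHolCalc_polynomial (X := X) 1

theorem hasHolCalc_id : HasHolCalc (fun z => z) X X := by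
  simpa using hasHolCalc_polynomial (X := X) Polynomial.X

/-- The value of the calculus at `(z + t)⁻¹` is a right inverse of `X + t` by multiplicativity,
hence the inverse. -/
theorem hasHolCalc_mul_add_inv (hX : spectrum ℂ X ⊆ Complex.slitPlane) {t : ℝ} (ht : 0 ≤ t) :
    HasHolCalc (fun z => z * (z + t)⁻¹) X (X * (X + (t : ℂ) • 1)⁻¹) := by
  have hne : ∀ z ∈ Complex.slitPlane, z + t ≠ 0 := fun z hz =>
    Complex.slitPlane_ne_zero (add_ofReal_mem_slitPlane hz ht)
  have hd : DifferentiableOn ℂ (fun z : ℂ => (z + t)⁻¹) Complex.slitPlane :=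
    DifferentiableOn.inv (by fun_prop) hne
  obtain ⟨M, hM⟩ := exists_hasHolCalc hX hd
  have h1 : HasHolCalc (fun z => z + t) X (X + (t : ℂ) • 1) := by
    have h := hasHolCalc_polynomial (X := X) (Polynomial.X + Polynomial.C (t : ℂ))
    simpa only [Polynomial.eval_add, Polynomial.eval_X, Polynomial.eval_C, map_add,
      Polynomial.aeval_X, Polynomial.aeval_C, Algebra.algebraMap_eq_smul_one] using h
  obtain ⟨γ, -, hγ⟩ := exists_contDiff_isDunfordContour hX
  have h2 : (X + (t : ℂ) • 1) * M = 1 := hγ.hasHolCalc_unique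
    ((h1.mul hM).congr fun z hz => (mul_inv_cancel₀ (hne z hz)).symm) hasHolCalc_one
  rw [Matrix.inv_eq_right_inv h2]
  exact hasHolCalc_id.mul hM

theorem exists_hasHolCalc_cpow (hX : spectrum ℂ X ⊆ Complex.slitPlane) (s : ℂ) :
    ∃ M, HasHolCalc (fun z => z ^ s) X M :=
  exists_hasHolCalc hX fun _ hw =>
    ((hasDerivAt_id _).cpow_const hw).differentiableAt.differentiableWithinAt

/-- The kernel whose two iterated integrals are compared to represent the power `X ^ l`. -/
theorem integrable_cpow_kernel (hl0 : 0 < l) (hl1 : l < 1) (hγ1 : ContDiff ℝ 1 γ)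
    (hγ : IsDunfordContour X γ) (i j : Fin n) :
    Integrable (fun p : ℝ × ℝ => ((p.2 ^ (l - 1) : ℝ) : ℂ) * (γ p.1 * (γ p.1 + p.2)⁻¹) *
      (γ p.1 • (1 : Matrix (Fin n) (Fin n) ℂ) - X)⁻¹ i j * deriv γ p.1)
      ((volume.restrict (Icc (0 : ℝ) 1)).prod (volume.restrict (Ioi (0 : ℝ)))) := by
  obtain ⟨C, hC0, hC⟩ := exists_norm_add_inv_le (isCompact_Icc.image hγ1.continuous)
    (image_subset_iff.2 hγ.mem_slitPlane)
  have hh : ContinuousOn (fun θ : ℝ => γ θ *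
      (γ θ • (1 : Matrix (Fin n) (Fin n) ℂ) - X)⁻¹ i j * deriv γ θ) (Icc 0 1) := by
    refine (hγ1.continuous.continuousOn.mul ?_).mul
      (hγ1.continuous_deriv le_rfl).continuousOn
    exact ((continuous_apply_apply i j).comp_continuousOn continuousOn_resolvent).comp
      hγ1.continuous.continuousOn hγ.mem_resolventSet
  obtain ⟨H, hH⟩ := isCompact_Icc.exists_bound_of_continuousOn hh
  have hae : ∀ᵐ p : ℝ × ℝ ∂((volume.restrict (Icc (0 : ℝ) 1)).prod (volume.restrict (Ioi (0 : ℝ)))),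
      p ∈ Icc (0 : ℝ) 1 ×ˢ Ioi (0 : ℝ) := by
    rw [Measure.prod_restrict]
    exact ae_restrict_mem (measurableSet_Icc.prod measurableSet_Ioi)
  have hcont : ContinuousOn (fun p : ℝ × ℝ => ((p.2 ^ (l - 1) : ℝ) : ℂ) * (γ p.1 + p.2)⁻¹ *
      (γ p.1 * (γ p.1 • (1 : Matrix (Fin n) (Fin n) ℂ) - X)⁻¹ i j * deriv γ p.1))
      (Icc (0 : ℝ) 1 ×ˢ Ioi (0 : ℝ)) := by
    refine ContinuousOn.mul (ContinuousOn.mul ?_ ?_) ?_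
    · exact (continuousOn_rpow_ofReal (l := l)).comp continuousOn_snd fun p hp => hp.2
    · refine ContinuousOn.inv₀ ?_ fun p hp => Complex.slitPlane_ne_zero
        (add_ofReal_mem_slitPlane (hγ.mem_slitPlane _ hp.1) (le_of_lt hp.2))
      have := hγ1.continuous
      fun_prop
    · exact hh.comp continuousOn_fst fun p hp => hp.1
  have hmeas := hcont.aestronglyMeasurable (μ := volume)
    (measurableSet_Icc.prod measurableSet_Ioi)
  rw [Measure.volume_eq_prod, ← Measure.prod_restrict] at hmeas
  -- `C` bounds the decay of `(γ θ + t)⁻¹` and `H` the factor depending on `θ` alone, so the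
  -- majorant is a product.
  have hbound := (integrable_const (μ := volume.restrict (Icc (0 : ℝ) 1)) (C * H)).mul_prod
    (integrableOn_rpow_mul_one_add_inv_real hl0 hl1)
  refine (hbound.mono' hmeas ?_).congr ?_
  · filter_upwards [hae] with p hp
    have h0 : 0 < p.2 := hp.2
    have h1 := hC _ (mem_image_of_mem γ hp.1) p.2 h0.le
    have h2 := hH _ hp.1
    have h3 := Real.rpow_nonneg h0.le (l - 1)
    have h4 : 0 ≤ (1 + p.2)⁻¹ := by positivity
    rw [norm_mul, norm_mul, Complex.norm_of_nonneg h3]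
    calc p.2 ^ (l - 1) * ‖(γ p.1 + p.2)⁻¹‖ * _ ≤ p.2 ^ (l - 1) * (C * (1 + p.2)⁻¹) * H := by
          gcongr
      _ = _ := by ring
  · filter_upwards with p
    ring

theorem cpow_kernel_integral_eq (hX : spectrum ℂ X ⊆ Complex.slitPlane)
    (hγ : IsDunfordContour X γ) (i j : Fin n) {t : ℝ} (ht : 0 ≤ t) :
    ∫ θ in Icc (0 : ℝ) 1, ((t ^ (l - 1) : ℝ) : ℂ) * (γ θ * (γ θ + t)⁻¹) *
      (γ θ • (1 : Matrix (Fin n) (Fin n) ℂ) - X)⁻¹ i j * deriv γ θ =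
    2 * Real.pi * Complex.I *
      (((t ^ (l - 1) : ℝ) : ℂ) * (X * (X + (t : ℂ) • 1)⁻¹) i j) := by
  rw [← (hasHolCalc_mul_add_inv hX ht).dunfordIntegral_eq hγ, dunfordIntegral, Matrix.of_apply,
    mul_left_comm, mul_inv_cancel_left₀ (by simp [Real.pi_ne_zero]), ← contourIntegral_const_mul,
    contourIntegral, intervalIntegral.integral_of_le zero_le_one, integral_Icc_eq_integral_Ioc]
  simp only [mul_assoc]

/-- Up to `2πi` this function is the `θ`-integral of the jointly integrable kernel. -/
theorem integrableOn_rpow_mul_resolvent (hl0 : 0 < l) (hl1 : l < 1)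
    (hX : spectrum ℂ X ⊆ Complex.slitPlane) (i j : Fin n) :
    IntegrableOn (fun t : ℝ => ((t ^ (l - 1) : ℝ) : ℂ) * (X * (X + (t : ℂ) • 1)⁻¹) i j)
      (Ioi 0) := by
  obtain ⟨γ, hγ1, hγ⟩ := exists_contDiff_isDunfordContour hX
  have h : Integrable _ (volume.restrict (Ioi (0 : ℝ))) :=
    ((integrable_cpow_kernel hl0 hl1 hγ1 hγ i j).integral_prod_right).const_mul
      (2 * Real.pi * Complex.I)⁻¹
  refine IntegrableOn.congr_fun h (fun t ht => ?_) measurableSet_Ioi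
  simp only
  rw [cpow_kernel_integral_eq hX hγ i j (le_of_lt ht),
    inv_mul_cancel_left₀ (by simp [Real.pi_ne_zero])]

/-- The power `X ^ l`, `0 < l < 1`, as an integral of resolvents over `(0, ∞)`. -/
theorem HasHolCalc.apply_eq_integral (hl0 : 0 < l) (hl1 : l < 1)
    (hX : spectrum ℂ X ⊆ Complex.slitPlane) {M : Matrix (Fin n) (Fin n) ℂ}
    (hM : HasHolCalc (fun z => z ^ (l : ℂ)) X M) (i j : Fin n) :
    M i j = ((Real.sin (l * Real.pi) / Real.pi : ℝ) : ℂ) *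
      ∫ t in Ioi (0 : ℝ), ((t ^ (l - 1) : ℝ) : ℂ) * (X * (X + (t : ℂ) • 1)⁻¹) i j := by
  obtain ⟨γ, hγ1, hγ⟩ := exists_contDiff_isDunfordContour hX
  have hpi : (2 * Real.pi * Complex.I : ℂ) ≠ 0 := by simp [Real.pi_ne_zero]
  -- Integrating over `θ` first gives `X (X + t)⁻¹`; integrating over `t` first gives `z^l` by the
  -- scalar formula.
  have hswap := integral_integral_swap (f := fun θ t : ℝ => ((t ^ (l - 1) : ℝ) : ℂ) *
    (γ θ * (γ θ + t)⁻¹) * (γ θ • (1 : Matrix (Fin n) (Fin n) ℂ) - X)⁻¹ i j * deriv γ θ)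
    (integrable_cpow_kernel hl0 hl1 hγ1 hγ i j)
  rw [setIntegral_congr_fun measurableSet_Ioi fun t ht =>
    cpow_kernel_integral_eq hX hγ i j (le_of_lt ht), integral_const_mul] at hswap
  rw [← hM.dunfordIntegral_eq hγ, dunfordIntegral, Matrix.of_apply, inv_mul_eq_iff_eq_mul₀ hpi,
    mul_left_comm, ← hswap, contourIntegral, intervalIntegral.integral_of_le zero_le_one,
    ← integral_Icc_eq_integral_Ioc, ← integral_const_mul]
  refine setIntegral_congr_fun measurableSet_Icc fun θ hθ => ?_
  simp only [cpow_eq_integral hl0 hl1 (hγ.mem_slitPlane θ hθ), integral_mul_const]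
  ring

/-! ### Eigenvalues of accretive matrices -/

theorem exists_eigenvector {z : ℂ} (hz : z ∈ spectrum ℂ X) : ∃ v, v ≠ 0 ∧ X *ᵥ v = z • v := by
  have h0 : (z • (1 : Matrix (Fin n) (Fin n) ℂ) - X).det = 0 := by
    rw [det_smul_one_sub]
    exact Matrix.mem_spectrum_iff_isRoot_charpoly.1 hz
  obtain ⟨v, hv, h⟩ := Matrix.exists_mulVec_eq_zero_iff.2 h0
  refine ⟨v, hv, ?_⟩
  rw [Matrix.sub_mulVec, Matrix.smul_mulVec, Matrix.one_mulVec, sub_eq_zero] at h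
  exact h.symm

theorem spectrum_subset_slitPlane (h : ∀ r : ℝ, r ≤ 0 → (r : ℂ) ∉ spectrum ℂ X) :
    spectrum ℂ X ⊆ Complex.slitPlane := by
  intro z hz
  by_contra hs
  rw [Complex.mem_slitPlane_iff] at hs
  push Not at hs
  refine h z.re hs.1 ?_
  rwa [show ((z.re : ℝ) : ℂ) = z from Complex.ext rfl hs.2.symm]

/-- The quadratic form of `Aᴴ` is the conjugate of that of `A`, so the form of the real part is the
real part of the form. -/
theorem IsAccretive.re_pos {A : Matrix (Fin n) (Fin n) ℂ} (hA : IsAccretive A) {x : Fin n → ℂ}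
    (hx : x ≠ 0) : 0 < (star x ⬝ᵥ A *ᵥ x).re := by
  have h := hA.re_dotProduct_pos hx
  have hstar : star x ⬝ᵥ Aᴴ *ᵥ x = star (star x ⬝ᵥ A *ᵥ x) := by
    rw [← Matrix.star_dotProduct_star, star_star, Matrix.star_mulVec, Matrix.dotProduct_mulVec]
  rw [Matrix.smul_mulVec, Matrix.add_mulVec, dotProduct_smul, dotProduct_add, hstar] at h
  simpa using h

theorem IsAccretive.notMem_spectrum {A : Matrix (Fin n) (Fin n) ℂ} (hA : IsAccretive A) (r : ℝ)
    (hr : r ≤ 0) : (r : ℂ) ∉ spectrum ℂ A := by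
  intro h
  obtain ⟨v, hv, hAv⟩ := exists_eigenvector h
  have h1 := hA.re_pos hv
  rw [hAv, dotProduct_smul, smul_eq_mul, Complex.re_ofReal_mul] at h1
  have h2 : 0 ≤ (star v ⬝ᵥ v).re := (Complex.le_def.1 (dotProduct_star_self_nonneg v)).1
  nlinarith

end AccretiveMean

/-! ### The mean as a product of powers -/

open AccretiveMean in
theorem theorem4p1 {n : ℕ} (A B : Matrix (Fin n) (Fin n) ℂ)
    (hA : AccretiveMean.IsAccretive A) (hB : AccretiveMean.IsAccretive B)
    (l : ℝ) (hl0 : 0 < l) (hl1 : l < 1) :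
    -- the powers `A ^ (1/2)` and `A ^ (-1/2)` are well defined
    AccretiveMean.DunfordPowWellDefined A (1 / 2) ∧
    AccretiveMean.DunfordPowWellDefined A (-1 / 2) ∧
    -- `A ^ (-1/2) B A ^ (-1/2)` has no eigenvalue in `(-∞, 0]`
    (∀ r : ℝ, r ≤ 0 →
      (r : ℂ) ∉ spectrum ℂ
        (AccretiveMean.dunfordPow A (-1 / 2) * B * AccretiveMean.dunfordPow A (-1 / 2))) ∧
    -- so its power with exponent `l` is well defined
    AccretiveMean.DunfordPowWellDefined
      (AccretiveMean.dunfordPow A (-1 / 2) * B * AccretiveMean.dunfordPow A (-1 / 2)) l ∧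
    -- the integral that defines the mean converges absolutely
    (∀ i j, IntegrableOn (fun t : ℝ => AccretiveMean.meanIntegrand A B l t i j) (Ioi 0)) ∧
    AccretiveMean.weightedGeometricMean A B l =
      AccretiveMean.dunfordPow A (1 / 2) *
        AccretiveMean.dunfordPow
          (AccretiveMean.dunfordPow A (-1 / 2) * B * AccretiveMean.dunfordPow A (-1 / 2)) l *
        AccretiveMean.dunfordPow A (1 / 2) := by
  have hAs := spectrum_subset_slitPlane hA.notMem_spectrum
  obtain ⟨γ, -, hγ⟩ := exists_contDiff_isDunfordContour hAs
  obtain ⟨D, hD⟩ := exists_hasHolCalc_cpow hAs ((1 / 2 : ℝ) : ℂ)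
  obtain ⟨E, hE⟩ := exists_hasHolCalc_cpow hAs ((-1 / 2 : ℝ) : ℂ)
  obtain ⟨hDw, hDe⟩ := dunfordPow_wellDefined_and_eq ⟨γ, hγ⟩ hD
  obtain ⟨hEw, hEe⟩ := dunfordPow_wellDefined_and_eq ⟨γ, hγ⟩ hE
  have hDD : D * D = A := hγ.hasHolCalc_unique ((hD.mul hD).congr fun z hz => by
    simp only
    rw [← Complex.cpow_add _ _ (Complex.slitPlane_ne_zero hz)]
    norm_num) hasHolCalc_id
  have hDE : D * E = 1 := hγ.hasHolCalc_unique ((hD.mul hE).congr fun z hz => by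
    simp only
    rw [← Complex.cpow_add _ _ (Complex.slitPlane_ne_zero hz)]
    norm_num) hasHolCalc_one
  have hED : E * D = 1 := mul_eq_one_comm.1 hDE
  rw [hDe, hEe]
  obtain ⟨C, hC⟩ : ∃ C, C = E * B * E := ⟨_, rfl⟩
  rw [← hC]
  have hspec : ∀ r : ℝ, r ≤ 0 → (r : ℂ) ∉ spectrum ℂ C := by
    intro r hr h
    obtain ⟨v, hv, hCv⟩ := exists_eigenvector h
    -- Multiplying `E B E v = r v` by `D` and using `D = A E` gives `B x = r A x` for `x = E v`; the
    -- real parts of the two forms then have incompatible signs.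
    have hBv : B *ᵥ (E *ᵥ v) = (r : ℂ) • A *ᵥ (E *ᵥ v) := by
      have h1 := congrArg (D *ᵥ ·) hCv
      simp only [Matrix.mulVec_smul, Matrix.mulVec_mulVec] at h1
      rw [hC, ← mul_assoc, ← mul_assoc, hDE, one_mul] at h1
      rw [Matrix.mulVec_mulVec, h1, Matrix.mulVec_mulVec, ← hDD, mul_assoc, hDE, mul_one]
    have hx : E *ᵥ v ≠ 0 := fun h0 => hv (by
      rw [← Matrix.one_mulVec v, ← hDE, ← Matrix.mulVec_mulVec, h0, Matrix.mulVec_zero])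
    have h1 := hA.re_pos hx
    have h2 := hB.re_pos hx
    rw [hBv, dotProduct_smul, smul_eq_mul, Complex.re_ofReal_mul] at h2
    nlinarith
  have hCs := spectrum_subset_slitPlane hspec
  obtain ⟨γ', -, hγ'⟩ := exists_contDiff_isDunfordContour hCs
  obtain ⟨P, hP⟩ := exists_hasHolCalc_cpow hCs (l : ℂ)
  obtain ⟨hPw, hPe⟩ := dunfordPow_wellDefined_and_eq ⟨γ', hγ'⟩ hP
  have hCu : IsUnit C.det := by
    rw [← Matrix.isUnit_iff_isUnit_det, ← spectrum.zero_notMem_iff ℂ]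
    simpa using hspec 0 le_rfl
  have hAinv : A⁻¹ = E * E := Matrix.inv_eq_right_inv (by
    rw [← hDD, mul_assoc, ← mul_assoc D E, hDE, one_mul, hDE])
  have hBinv : B⁻¹ = E * C⁻¹ * E := Matrix.inv_eq_left_inv (by
    have : E * B = C * D := by rw [hC, mul_assoc, hED, mul_one]
    rw [mul_assoc, this, mul_assoc, ← mul_assoc C⁻¹, Matrix.nonsing_inv_mul _ hCu, one_mul, hED])
  have hint : ∀ t ∈ Ioi (0 : ℝ), meanIntegrand A B l t =
      D * (((t ^ (l - 1) : ℝ) : ℂ) • (C * (C + (t : ℂ) • 1)⁻¹)) * D := by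
    intro t ht
    have hu : IsUnit (C + (t : ℂ) • 1).det := by
      have h1 := hspec (-t) (neg_nonpos.2 (le_of_lt ht))
      have h2 := isUnit_smul_one_sub (X := C) (z := ((-t : ℝ) : ℂ)) (not_not.1 h1)
      rw [← Matrix.isUnit_iff_isUnit_det, ← IsUnit.neg_iff]
      convert h2 using 1
      push_cast
      rw [neg_smul]
      abel
    have hinv : (A⁻¹ + (t : ℂ) • B⁻¹)⁻¹ = D * (C * (C + (t : ℂ) • 1)⁻¹) * D := by
      refine Matrix.inv_eq_left_inv ?_
      -- Both inverses are congruent by `E` to functions of `C`: `E E` and `E C⁻¹ E`.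
      have h1 : A⁻¹ + (t : ℂ) • B⁻¹ = E * ((C + (t : ℂ) • 1) * (C⁻¹ * E)) := by
        rw [hAinv, hBinv, add_mul, ← mul_assoc C, Matrix.mul_nonsing_inv _ hCu, one_mul, mul_add,
          smul_mul_assoc, one_mul, mul_smul_comm, mul_assoc]
      rw [h1, mul_assoc, ← mul_assoc D E, hDE, one_mul, mul_assoc D, mul_assoc C,
        ← mul_assoc (C + (t : ℂ) • 1)⁻¹, Matrix.nonsing_inv_mul _ hu, one_mul, ← mul_assoc C,
        Matrix.mul_nonsing_inv _ hCu, one_mul, hDE]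
    rw [meanIntegrand, hinv, mul_smul_comm, smul_mul_assoc]
  -- The integrals are entrywise, so the constant outer factors `D` leave them through finite sums.
  have hentry : ∀ i j, ∀ t ∈ Ioi (0 : ℝ), meanIntegrand A B l t i j = ∑ k, ∑ m,
      D i m * (((t ^ (l - 1) : ℝ) : ℂ) * (C * (C + (t : ℂ) • 1)⁻¹) m k) * D k j := by
    intro i j t ht
    rw [hint t ht, Matrix.mul_apply]
    refine Finset.sum_congr rfl fun k _ => ?_
    rw [Matrix.mul_apply, Finset.sum_mul]
    rfl
  have hI : ∀ i j k m, IntegrableOn (fun t : ℝ => D i m *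
      (((t ^ (l - 1) : ℝ) : ℂ) * (C * (C + (t : ℂ) • 1)⁻¹) m k) * D k j) (Ioi 0) :=
    fun i j k m => ((integrableOn_rpow_mul_resolvent hl0 hl1 hCs m k).const_mul _).mul_const _
  refine ⟨hDw, hEw, hspec, hPw, fun i j => ?_, ?_⟩
  · refine IntegrableOn.congr_fun ?_ (fun t ht => (hentry i j t ht).symm) measurableSet_Ioi
    exact integrable_finsetSum _ fun k _ => integrable_finsetSum _ fun m _ => hI i j k m
  · rw [hPe]
    ext i j
    rw [weightedGeometricMean, Matrix.smul_apply, Matrix.of_apply,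
      setIntegral_congr_fun measurableSet_Ioi (hentry i j),
      integral_finsetSum _ fun k _ => integrable_finsetSum _ fun m _ => hI i j k m,
      Matrix.mul_apply, smul_eq_mul, Finset.mul_sum]
    refine Finset.sum_congr rfl fun k _ => ?_
    rw [integral_finsetSum _ fun m _ => hI i j k m, Matrix.mul_apply, Finset.mul_sum,
      Finset.sum_mul]
    refine Finset.sum_congr rfl fun m _ => ?_
    rw [integral_mul_const, integral_const_mul, hP.apply_eq_integral hl0 hl1 hCs]
    ring
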